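/- Let $G=(V,E)$ be a finite connected undirected simple graph with a nonempty set $S\subseteq V$ of leaders; the elements of $V\setminus S$ are the followers. Write $N(i)$ for the set of neighbors of $i$. Let $\nu_{ij}=\nu_{ji}>0$ for $(i,j)\in E$, and put $D_i=\sum_{j\in N(i)}\nu_{ij}^{-1}$ and $W_{ij}=\nu_{ij}^{-1}/D_i$ (the best linear unbiased estimator weights). Let $L$ be the weighted Laplacian, with $L_{ii}=D_i$, $L_{ij}=-\nu_{ij}^{-1}$ for $(i,j)\in E$, and all other entries $0$. Let $L_{ff}$ and $L_{fl}$ be its blocks with rows indexed by the followers and columns indexed by the followers, respectively by the leaders. Let $r_{ij}\in\mathbb R$ for every oriented edge $(i,j)$, and let $x_l^*\in\mathbb R^{S}$ be the constant states of the leaders. Suppose that the random process $x(t)$, $t\ge 0$, satisfies $x_l(t)\equiv x_l^*$ for the leaders and $$\dot x_i(t)=-\sum_{j\in N(i)}W_{ij}\bigl(x_i(t)-x_j(t)-r_{ij}+\epsilon_{ij}(t)\bigr),\qquad i\in V\setminus S,$$ for the followers, where the $x_i(0)$, $i \in V\setminus S$, are square integrable, and the $\epsilon_{ij}$, one for each oriented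 edge $(i,j)$, are independent zero-mean white noise processes with $\mathbf E(\epsilon_{ij}(t)\epsilon_{ij}(t+\tau))=\nu_{ij}\delta(\tau)$. The equation is understood in integrated form: almost surely, the paths of $x$ are locally integrable and, for all $t\ge0$, $$x_i(t)=x_i(0)-\int_0^t\sum_{j\in N(i)}W_{ij}(x_i(s)-x_j(s)-r_{ij})\,ds-\sum_{j\in N(i)}W_{ij}\beta_{ij}(t),$$ where $\beta_{ij}(t)=\int_0^t\epsilon_{ij}(s)\,ds$, $t\ge 0$, is a jointly measurable, zero-mean, square integrable process (not necessarily Gaussian) with $\mathbf E(\beta_{ij}(s)\beta_{ij}(t))=\nu_{ij}\min(s,t)$. Then $L_{ff}$ is invertible. Let $x_f^*=-L_{ff}^{-1}(L_{fl}x_l^*+b)$, where $b_i=\sum_{j\in N(i)}L_{ij}r_{ij}$ for $i \in V\setminus S$, be the desired state of the followers; if some $y\in\mathbb R^V$ satisfies $y_i-y_j=r_{ij}$ for all oriented edges $(i,j)$ and agrees with $x_l^*$ on $S$, then $x_f^*$ is the restriction of $y$ to $V\setminus S$. Moreover, $\mathbf E\|x_f(t)-x_f^*\|_2^2<\infty$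 for all $t\ge0$, and the system error $R(S)=\lim_{t\to\infty}\mathbf E\|x_f(t)-x_f^*\|_2^2$ exists and equals $$R(S)=\tfrac12\operatorname{Tr}(L_{ff}^{-1})=\tfrac12\sum_{u\in V\setminus S}(L_{ff}^{-1})_{uu}.$$ -/

import Mathlib

open MeasureTheory ProbabilityTheory Filter Topology
open scoped NNReal Matrix

namespace LeaderFollower

noncomputable section

/-- `β` is the time integral `β(t) = ∫₀ᵗ ε(s) ds`, `t ≥ 0`, of a zero-mean white noise process `ε`
with autocorrelation `E(ε(t) ε(t + τ)) = c δ(τ)`, where `δ` is the unit impulse. White noise has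
no pointwise values, so it is described by its integral: integrating the autocorrelation over
`[0, s] × [0, t]` gives `E(β(s) β(t)) = c min(s, t)`. The noise need not be Gaussian;
`√c` times a Brownian motion is an example. -/
structure IsIntegratedWhiteNoise {Ω : Type*} [MeasurableSpace Ω]
    (β : ℝ → Ω → ℝ) (c : ℝ) (P : Measure Ω) : Prop where
  /-- joint measurability in time and chance -/
  aestronglyMeasurable :
    AEStronglyMeasurable (Function.uncurry β) ((volume.restrict (Set.Ici (0 : ℝ))).prod P)
  memLp : ∀ t : ℝ, 0 ≤ t → MemLp (β t) 2 P
  mean_zero : ∀ t : ℝ, 0 ≤ t → ∫ ω, β t ω ∂P = 0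
  autocorrelation : ∀ s t : ℝ, 0 ≤ s → 0 ≤ t → ∫ ω, β s ω * β t ω ∂P = c * min s t

section Graph

variable {V : Type*} [Fintype V] [DecidableEq V] (G : SimpleGraph V) [DecidableRel G.Adj]
  (ν : V → V → ℝ) (S : Finset V)

/-- `D_i = ∑_{j ∈ N(i)} ν_ij⁻¹`. -/
def weightedDegree (i : V) : ℝ := ∑ j ∈ G.neighborFinset i, (ν i j)⁻¹

/-- The best linear unbiased estimator link weights `W_ij = ν_ij⁻¹ / D_i`. -/
def blueWeight (i j : V) : ℝ := (ν i j)⁻¹ / weightedDegree G ν i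

/-- The weighted Laplacian `L`. -/
def laplacian : Matrix V V ℝ :=
  Matrix.of fun i j =>
    if i = j then weightedDegree G ν i else if G.Adj i j then -(ν i j)⁻¹ else 0

/-- The follower-follower block of the Laplacian. -/
def Lff : Matrix {i // i ∉ S} {i // i ∉ S} ℝ :=
  (laplacian G ν).submatrix Subtype.val Subtype.val

/-- The follower-leader block of the Laplacian. -/
def Lfl : Matrix {i // i ∉ S} {i // i ∈ S} ℝ :=
  (laplacian G ν).submatrix Subtype.val Subtype.val

/-- The matrix `B` with rows indexed by followers and columns by oriented edges: the entry at
`(i, l)` is `L_ij` if `l` is the oriented edge `(i, j)`, and `0` if `l` does not start at `i`. -/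
def edgeMatrix : Matrix {i // i ∉ S} G.Dart ℝ :=
  Matrix.of fun i l => if l.fst = i.val then laplacian G ν l.fst l.snd else 0

/-- The desired follower state `x_f* = -L_ff⁻¹ (L_fl x_l* + B r)`. -/
def desiredState (r : V → V → ℝ) (xl : {i // i ∈ S} → ℝ) : {i // i ∉ S} → ℝ :=
  -((Lff G ν S)⁻¹ *ᵥ
    (Lfl G ν S *ᵥ xl + edgeMatrix G ν S *ᵥ fun l : G.Dart => r l.fst l.snd))

/-- `x` is a solution of the noisy leader-follower dynamics on `[0, ∞)`: the leaders stay at `xl`,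
and each follower `i` satisfies
`dx_i/dt = -∑_{j ∈ N(i)} W_ij (x_i - x_j - r_ij + ε_ij)`,
read in integrated form, where `β i j` is the time integral of the noise `ε_ij` that affects the
measurement made by `i` of its state relative to `j`. -/
structure IsSolution {Ω : Type*} [MeasurableSpace Ω] (r : V → V → ℝ) (xl : {i // i ∈ S} → ℝ)
    (β : V → V → ℝ → Ω → ℝ) (x : V → ℝ → Ω → ℝ) (P : Measure Ω) : Prop where
  leader : ∀ᵐ ω ∂P, ∀ (l : {i // i ∈ S}) (t : ℝ), 0 ≤ t → x l t ω = xl l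
  intervalIntegrable : ∀ᵐ ω ∂P, ∀ i ∉ S, ∀ t : ℝ, 0 ≤ t →
    IntervalIntegrable (fun s => x i s ω) volume 0 t
  follower : ∀ᵐ ω ∂P, ∀ i ∉ S, ∀ t : ℝ, 0 ≤ t →
    x i t ω = x i 0 ω
      - (∫ s in (0 : ℝ)..t, ∑ j ∈ G.neighborFinset i,
          blueWeight G ν i j * (x i s ω - x j s ω - r i j))
      - ∑ j ∈ G.neighborFinset i, blueWeight G ν i j * β i j t ω

/-- The squared Euclidean error `‖x_f(t) - x_f*‖²` of the followers. -/
def squaredError {Ω : Type*} (r : V → V → ℝ) (xl : {i // i ∈ S} → ℝ)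
    (x : V → ℝ → Ω → ℝ) (t : ℝ) (ω : Ω) : ℝ :=
  ‖(WithLp.toLp 2 fun i : {i // i ∉ S} => x i t ω - desiredState G ν S r xl i :
    EuclideanSpace ℝ {i // i ∉ S})‖ ^ 2

/-- The total error `E ‖x_f(t) - x_f*‖²` at time `t`. -/
def totalError {Ω : Type*} [MeasurableSpace Ω] (r : V → V → ℝ) (xl : {i // i ∈ S} → ℝ)
    (x : V → ℝ → Ω → ℝ) (P : Measure Ω) (t : ℝ) : ℝ :=
  ∫ ω, squaredError G ν S r xl x t ω ∂P

end Graph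

end

end LeaderFollower

/-!
The error `y = x_f - x_f*` of the followers satisfies `y' = -D⁻¹ L_ff y - w'`, where `w_i` is the
weighted sum of the noises measured at `i` (`sum_mismatch_eq`, `IsSolution.ae_error_eq`). The
weights `ν_ij⁻¹ / D_i` are such that `w` has covariance `D⁻¹ min(s, t)`
(`weightMatrix_mul_diagonal_mul`), and `L_ff` is positive definite, because its quadratic form is the
Dirichlet energy of functions that vanish on the leaders (`Lff_posDef`).

With `U` an orthonormal eigenbasis of `D^{-1/2} L_ff D^{-1/2}` and eigenvalues `a_k`, the coordinates
`u = Uᵀ D^{1/2} y` decouple into `u_k' = -a_k u_k - m_k'`, where the `m_k` are uncorrelated with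
covariance `min(s, t)` (`exists_diagonalization`, `modal_solution`). Hence
`E(u_k u_l) → δ_kl / (2 a_k)`, and `E ‖y‖² = E ‖D^{-1/2} U u‖²` tends to
`½ Tr(D^{-1/2} U diag(a)⁻¹ Uᵀ D^{-1/2}) = ½ Tr(L_ff⁻¹)` (`tendsto_integral_sum_sq`).

Only second moments are available, so no stochastic calculus is used. The scalar equation is solved
path by path, as `u(t) = e^{-at} u(0) + ∫₀ᵗ a e^{-a(t-s)} m(s) ds - m(t)`
(`eq_exp_mul_add_expAverage_sub`), and the covariances of the last two terms follow from Fubini's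
theorem and elementary integrals (`integral_expAverage_sub_mul`). The initial values may be
correlated with the noise; they drop out in the limit, because they are damped exponentially while
the noise terms stay bounded in `L²` (`tendsto_integral_mul`).
-/

namespace LeaderFollower

/-! ### The scalar relaxation equation -/

/-- The exponential moving average `∫₀ᵗ a e^{-a(t-s)} f(s) ds` of `f` with rate `a`. -/
noncomputable def expAverage (a : ℝ) (f : ℝ → ℝ) (t : ℝ) : ℝ :=
  ∫ s in (0 : ℝ)..t, a * Real.exp (-a * (t - s)) * f s

theorem hasDerivAt_exp_neg_mul_sub (a t s : ℝ) :
    HasDerivAt (fun s => Real.exp (-a * (t - s))) (a * Real.exp (-a * (t - s))) s := by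
  have h := (((hasDerivAt_id s).const_sub t).const_mul (-a)).exp
  simpa [mul_comm] using h

/-- Variation of constants for `u' = -a u - m'` in integrated form. The forcing `m` is only
as regular as `u`, so the derivative of `m` is moved onto the kernel: integration by parts is
applied to the absolutely continuous function `s ↦ ∫₀ˢ u`. -/
theorem eq_exp_mul_add_expAverage_sub {a t : ℝ} {u m : ℝ → ℝ} (ht : 0 ≤ t)
    (hu : IntervalIntegrable u volume 0 t)
    (h : ∀ s, 0 ≤ s → u s = u 0 - a * (∫ r in (0 : ℝ)..s, u r) - m s) :
    u t = Real.exp (-a * t) * u 0 + (expAverage a m t - m t) := by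
  set U : ℝ → ℝ := fun s => ∫ r in (0 : ℝ)..s, u r with hU
  set f : ℝ → ℝ := fun s => Real.exp (-a * (t - s)) with hf
  have hfd : ∀ s, HasDerivAt f (a * f s) s := hasDerivAt_exp_neg_mul_sub a t
  have hfc : Continuous f := by fun_prop
  have hUac : AbsolutelyContinuousOnInterval U 0 t :=
    hu.absolutelyContinuousOnInterval_intervalIntegral (by simp)
  have hfac : AbsolutelyContinuousOnInterval f 0 t := by
    apply ContDiffOn.absolutelyContinuousOnInterval
    exact (by fun_prop : ContDiff ℝ 1 f).contDiffOn
  have hparts := hfac.integral_mul_deriv_eq_deriv_mul hUac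
  have hUd : ∫ s in (0 : ℝ)..t, f s * deriv U s = ∫ s in (0 : ℝ)..t, f s * u s := by
    apply intervalIntegral.integral_congr_ae
    filter_upwards [hu.ae_hasDerivAt_integral] with s hs hs'
    rw [(hs (Set.uIoc_subset_uIcc hs') 0 (by simp)).deriv]
  have hfdU : ∫ s in (0 : ℝ)..t, deriv f s * U s = ∫ s in (0 : ℝ)..t, a * (f s * U s) := by
    congr 1; ext s; rw [(hfd s).deriv]; ring
  have hUi : IntervalIntegrable (fun s => f s * U s) volume 0 t :=
    (hfc.continuousOn.mul hUac.continuousOn).intervalIntegrable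
  have hfu : IntervalIntegrable (fun s => f s * u s) volume 0 t :=
    hu.continuousOn_mul hfc.continuousOn
  have hfi : ∫ s in (0 : ℝ)..t, a * f s = f t - f 0 :=
    intervalIntegral.integral_eq_sub_of_hasDerivAt (fun s _ => hfd s)
      (by fun_prop : Continuous fun s => a * f s).continuousOn.intervalIntegrable
  have hm : expAverage a m t
      = ∫ s in (0 : ℝ)..t, (u 0 * (a * f s) - a * (a * (f s * U s)) - a * (f s * u s)) := by
    apply intervalIntegral.integral_congr
    intro s hs
    rw [Set.uIcc_of_le ht] at hs
    have := h s hs.1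
    have hms : m s = u 0 - a * U s - u s := by rw [hU]; dsimp only; linarith
    simp only [hms, hf]; ring
  rw [intervalIntegral.integral_sub, intervalIntegral.integral_sub,
    intervalIntegral.integral_const_mul, hfi, intervalIntegral.integral_const_mul,
    intervalIntegral.integral_const_mul (r := a) (f := fun s => f s * u s)] at hm
  rotate_left
  · exact (by fun_prop : Continuous fun s => u 0 * (a * f s)).intervalIntegrable _ _
  · exact (hUi.const_mul _).const_mul _
  · exact ((by fun_prop : Continuous fun s => u 0 * (a * f s)).intervalIntegrable _ _).sub
      ((hUi.const_mul _).const_mul _)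
  · exact hfu.const_mul _
  rw [hUd, hfdU] at hparts
  have hft : f t = 1 := by simp [hf]
  have hf0 : f 0 = Real.exp (-a * t) := by simp [hf]
  have hU0 : U 0 = 0 := by simp [hU]
  rw [hft, hU0] at hparts
  have hut := h t ht
  change u t = u 0 - a * U t - m t at hut
  rw [hm, hft, ← hf0, hut, hparts]
  ring

/-- With `r` and `t` fixed, this is the covariance of the value at time `r` of a noise of unit
intensity with its exponential moving average at time `t`. -/
theorem expAverage_min {a r t : ℝ} (ha : a ≠ 0) (hr : 0 ≤ r) (hrt : r ≤ t) :
    expAverage a (fun s => min s r) t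
      = r - (Real.exp (-a * (t - r)) - Real.exp (-a * t)) / a := by
  have hd := hasDerivAt_exp_neg_mul_sub a t
  have hc : Continuous fun s => a * Real.exp (-a * (t - s)) * min s r := by fun_prop
  unfold expAverage
  rw [← intervalIntegral.integral_add_adjacent_intervals (hc.intervalIntegrable 0 r)
    (hc.intervalIntegrable r t)]
  have h1 : ∫ s in (0 : ℝ)..r, a * Real.exp (-a * (t - s)) * min s r
      = (r - 1 / a) * Real.exp (-a * (t - r)) - (0 - 1 / a) * Real.exp (-a * (t - 0)) := by
    rw [← intervalIntegral.integral_eq_sub_of_hasDerivAt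
      (f := fun s => (s - 1 / a) * Real.exp (-a * (t - s)))
      (f' := fun s => a * Real.exp (-a * (t - s)) * s)]
    · apply intervalIntegral.integral_congr
      intro s hs
      rw [Set.uIcc_of_le hr] at hs
      simp [min_eq_left hs.2]
    · intro s _
      convert! ((hasDerivAt_id s).sub_const (1 / a)).mul (hd s) using 1
      simp only [id]; field_simp; ring
    · exact (by fun_prop : Continuous fun s => a * Real.exp (-a * (t - s)) * s).intervalIntegrable
        _ _
  have h2 : ∫ s in r..t, a * Real.exp (-a * (t - s)) * min s r
      = r * Real.exp (-a * (t - t)) - r * Real.exp (-a * (t - r)) := by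
    rw [← intervalIntegral.integral_eq_sub_of_hasDerivAt
      (f := fun s => r * Real.exp (-a * (t - s)))
      (f' := fun s => a * Real.exp (-a * (t - s)) * r)]
    · apply intervalIntegral.integral_congr
      intro s hs
      rw [Set.uIcc_of_le hrt] at hs
      simp [min_eq_right hs.1]
    · intro s _
      convert! (hd s).const_mul r using 1
      ring
    · exact (by fun_prop : Continuous fun s => a * Real.exp (-a * (t - s)) * r).intervalIntegrable
        _ _
  rw [h1, h2]
  simp only [sub_self, mul_zero, Real.exp_zero, sub_zero]
  field_simp; ring

/-- The covariance of the exponential moving averages, with rates `a` and `b`, of a noise of unit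
intensity. -/
theorem expAverage_expAverage_min {a b t : ℝ} (ha : 0 < a) (hb : 0 < b) (ht : 0 ≤ t) :
    expAverage b (fun r => expAverage a (fun s => min s r) t) t
      = t - (1 - Real.exp (-a * t)) / a - (1 - Real.exp (-b * t)) / b
        + (1 - Real.exp (-(a + b) * t)) / (a + b) := by
  have hda := hasDerivAt_exp_neg_mul_sub a t
  have hdb := hasDerivAt_exp_neg_mul_sub b t
  have hab : a + b ≠ 0 := by positivity
  have hexp : ∀ s, Real.exp (-(a + b) * s) = Real.exp (-a * s) * Real.exp (-b * s) := by
    intro s; rw [← Real.exp_add]; ring_nf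
  let F : ℝ → ℝ := fun r => (r - 1 / b) * Real.exp (-b * (t - r))
    - b / (a * (a + b)) * (Real.exp (-a * (t - r)) * Real.exp (-b * (t - r)))
    + Real.exp (-a * t) / a * Real.exp (-b * (t - r))
  have h : expAverage b (fun r => expAverage a (fun s => min s r) t) t = F t - F 0 := by
    rw [← intervalIntegral.integral_eq_sub_of_hasDerivAt (f := F)
      (f' := fun r => b * Real.exp (-b * (t - r))
        * (r - (Real.exp (-a * (t - r)) - Real.exp (-a * t)) / a))]
    · apply intervalIntegral.integral_congr
      intro s hs
      rw [Set.uIcc_of_le ht] at hs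
      simp only [expAverage_min ha.ne' hs.1 hs.2]
    · intro s _
      convert! ((((hasDerivAt_id s).sub_const (1 / b)).mul (hdb s)).sub
        (((hda s).mul (hdb s)).const_mul (b / (a * (a + b))))).add
        ((hdb s).const_mul (Real.exp (-a * t) / a)) using 1
      simp only [id]; field_simp; ring
    · exact Continuous.intervalIntegrable (by fun_prop) _ _
  rw [h]
  simp only [F, hexp, sub_self, mul_zero, Real.exp_zero, sub_zero]
  field_simp; ring

/-! ### Second moments of filtered white noise -/

theorem sq_intervalIntegral_le {g : ℝ → ℝ} {t : ℝ} (ht : 0 ≤ t)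
    (hg : AEStronglyMeasurable g (volume.restrict (Set.uIoc 0 t)))
    (hg2 : IntervalIntegrable (fun s => g s ^ 2) volume 0 t) :
    (∫ s in (0 : ℝ)..t, g s) ^ 2 ≤ t * ∫ s in (0 : ℝ)..t, g s ^ 2 := by
  rcases ht.eq_or_lt with rfl | ht0
  · simp
  have hmem : MemLp g 2 (volume.restrict (Set.uIoc 0 t)) :=
    (memLp_two_iff_integrable_sq hg).2 (intervalIntegrable_iff.1 hg2)
  have hgi : IntervalIntegrable g volume 0 t := by
    rw [Set.uIoc_of_le ht] at hmem
    exact (intervalIntegrable_iff_integrableOn_Ioc_of_le ht).2 (hmem.integrable one_le_two)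
  -- `c` is the mean of `g` on `[0, t]`; the claim is that its variance is nonnegative
  set c := (∫ s in (0 : ℝ)..t, g s) / t with hc
  have h0 : 0 ≤ ∫ s in (0 : ℝ)..t, (g s - c) ^ 2 :=
    intervalIntegral.integral_nonneg ht fun s _ => sq_nonneg _
  have hexp : ∫ s in (0 : ℝ)..t, (g s - c) ^ 2
      = (∫ s in (0 : ℝ)..t, g s ^ 2) - 2 * c * (∫ s in (0 : ℝ)..t, g s) + c ^ 2 * t := by
    have : ∀ s, (g s - c) ^ 2 = g s ^ 2 - 2 * c * g s + c ^ 2 := fun s => by ring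
    simp only [this]
    rw [intervalIntegral.integral_add (hg2.sub (hgi.const_mul _)) (by simp),
      intervalIntegral.integral_sub hg2 (hgi.const_mul _), intervalIntegral.integral_const_mul]
    simp [mul_comm]
  have hct : (∫ s in (0 : ℝ)..t, g s) = c * t := by rw [hc]; field_simp
  rw [hexp, hct] at h0
  rw [hct]
  nlinarith [mul_nonneg ht h0]

namespace IsIntegratedWhiteNoise

variable {Ω : Type*} [MeasurableSpace Ω] {P : Measure Ω}
  {β γ : ℝ → Ω → ℝ} {c d : ℝ}

theorem integral_sq (hβ : IsIntegratedWhiteNoise β c P) {s : ℝ} (hs : 0 ≤ s) :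
    ∫ ω, β s ω ^ 2 ∂P = c * s := by
  simpa [sq] using hβ.autocorrelation s s hs hs

variable [IsProbabilityMeasure P]

theorem aestronglyMeasurable_uIoc (hβ : IsIntegratedWhiteNoise β c P) {t : ℝ} (ht : 0 ≤ t)
    {f : ℝ → ℝ} (hf : Continuous f) :
    AEStronglyMeasurable (fun p : ℝ × Ω => f p.1 * β p.1 p.2)
      ((volume.restrict (Set.uIoc 0 t)).prod P) := by
  have hle : (volume.restrict (Set.uIoc 0 t)).prod P
      ≤ (volume.restrict (Set.Ici (0 : ℝ))).prod P := by
    apply Measure.prod_mono _ le_rfl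
    apply Measure.restrict_mono _ le_rfl
    rw [Set.uIoc_of_le ht]
    exact fun s hs => hs.1.le
  exact (hf.measurable.comp measurable_fst).aestronglyMeasurable.mul
    (hβ.aestronglyMeasurable.mono_measure hle)

/-- The integrability needed to exchange the time integral of the noise with the expectation
against a square integrable variable `Z`. -/
theorem integrable_prod_mul (hβ : IsIntegratedWhiteNoise β c P) {t : ℝ} (ht : 0 ≤ t)
    {f : ℝ → ℝ} (hf : Continuous f) {Z : Ω → ℝ} (hZ : MemLp Z 2 P) :
    Integrable (fun p : ℝ × Ω => f p.1 * β p.1 p.2 * Z p.2)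
      ((volume.restrict (Set.uIoc 0 t)).prod P) := by
  have hmeas : AEStronglyMeasurable (fun p : ℝ × Ω => f p.1 * β p.1 p.2 * Z p.2)
      ((volume.restrict (Set.uIoc 0 t)).prod P) :=
    (hβ.aestronglyMeasurable_uIoc ht hf).mul hZ.1.comp_snd
  have hpos : ∀ᵐ s ∂(volume.restrict (Set.uIoc 0 t)), 0 ≤ s := by
    rw [Set.uIoc_of_le ht]
    filter_upwards [ae_restrict_mem measurableSet_Ioc] with s hs using hs.1.le
  refine (integrable_prod_iff hmeas).2 ⟨?_, ?_⟩
  · filter_upwards [hpos] with s hs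
    exact ((hβ.memLp s hs).const_mul (f s)).integrable_mul hZ
  · have hb : Integrable (fun s => |f s| * ((c * s + ∫ ω, Z ω ^ 2 ∂P) / 2))
        (volume.restrict (Set.uIoc 0 t)) :=
      intervalIntegrable_iff.1 (Continuous.intervalIntegrable (by fun_prop) 0 t)
    refine hb.mono' hmeas.norm.integral_prod_right' ?_
    filter_upwards [hpos] with s hs
    have hβ2 := (hβ.memLp s hs).integrable_sq
    have hZ2 := hZ.integrable_sq
    rw [Real.norm_of_nonneg (integral_nonneg fun ω => norm_nonneg _), ← hβ.integral_sq hs,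
      ← integral_add hβ2 hZ2, ← integral_div, ← integral_const_mul]
    refine integral_mono (((hβ.memLp s hs).const_mul (f s)).integrable_mul hZ).norm
      (((hβ2.add hZ2).div_const 2).const_mul _) fun ω => ?_
    simp only [Real.norm_eq_abs, abs_mul, mul_assoc]
    refine mul_le_mul_of_nonneg_left ?_ (abs_nonneg _)
    nlinarith [sq_nonneg (|β s ω| - |Z ω|), sq_abs (β s ω), sq_abs (Z ω)]

/-- Time averages of the noise are square integrable. -/
theorem memLp_intervalIntegral (hβ : IsIntegratedWhiteNoise β c P) {t : ℝ} (ht : 0 ≤ t)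
    {f : ℝ → ℝ} (hf : Continuous f) :
    MemLp (fun ω => ∫ s in (0 : ℝ)..t, f s * β s ω) 2 P := by
  have hmeas := hβ.aestronglyMeasurable_uIoc ht hf
  have hae : AEStronglyMeasurable (fun ω => ∫ s in (0 : ℝ)..t, f s * β s ω) P := by
    simpa only [intervalIntegral.integral_of_le ht, Set.uIoc_of_le ht, Prod.swap] using
      hmeas.prod_swap.integral_prod_right'
  have hsq : Integrable (fun p : ℝ × Ω => (f p.1 * β p.1 p.2) ^ 2)
      ((volume.restrict (Set.uIoc 0 t)).prod P) := by
    refine (integrable_prod_iff (hmeas.pow 2)).2 ⟨?_, ?_⟩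
    · rw [Set.uIoc_of_le ht]
      filter_upwards [ae_restrict_mem measurableSet_Ioc] with s hs
      exact ((hβ.memLp s hs.1.le).const_mul (f s)).integrable_sq
    · have hb : Integrable (fun s => f s ^ 2 * (c * s)) (volume.restrict (Set.uIoc 0 t)) :=
        intervalIntegrable_iff.1 (Continuous.intervalIntegrable (by fun_prop) 0 t)
      refine hb.congr ?_
      rw [Set.uIoc_of_le ht]
      filter_upwards [ae_restrict_mem measurableSet_Ioc] with s hs
      rw [← hβ.integral_sq hs.1.le, ← integral_const_mul]
      congr 1; ext ω
      rw [Pi.pow_apply, Real.norm_of_nonneg (sq_nonneg _), mul_pow]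
  refine (memLp_two_iff_integrable_sq hae).2 ?_
  have hI : Integrable (fun ω => t * ∫ s in (0 : ℝ)..t, (f s * β s ω) ^ 2) P := by
    simpa only [intervalIntegral.integral_of_le ht, Set.uIoc_of_le ht] using
      hsq.integral_prod_right.const_mul t
  refine hI.mono' (hae.pow 2) ?_
  filter_upwards [hmeas.prodMk_right, hsq.prod_left_ae] with ω h1 h2
  rw [Real.norm_of_nonneg (sq_nonneg _)]
  exact sq_intervalIntegral_le ht h1 (intervalIntegrable_iff.2 h2)

theorem integral_intervalIntegral_mul (hβ : IsIntegratedWhiteNoise β c P) {t : ℝ} (ht : 0 ≤ t)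
    {f : ℝ → ℝ} (hf : Continuous f) {Z : Ω → ℝ} (hZ : MemLp Z 2 P) :
    ∫ ω, (∫ s in (0 : ℝ)..t, f s * β s ω) * Z ω ∂P
      = ∫ s in (0 : ℝ)..t, f s * ∫ ω, β s ω * Z ω ∂P := by
  simp_rw [← intervalIntegral.integral_mul_const, ← integral_const_mul, ← mul_assoc]
  exact (intervalIntegral_integral_swap (hβ.integrable_prod_mul ht hf hZ)).symm

theorem memLp_expAverage (hβ : IsIntegratedWhiteNoise β c P) {a t : ℝ} (ht : 0 ≤ t) :
    MemLp (fun ω => expAverage a (fun s => β s ω) t) 2 P :=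
  hβ.memLp_intervalIntegral ht (by fun_prop)

theorem memLp_expAverage_sub (hβ : IsIntegratedWhiteNoise β c P) {a t : ℝ} (ht : 0 ≤ t) :
    MemLp (fun ω => expAverage a (fun s => β s ω) t - β t ω) 2 P :=
  (hβ.memLp_expAverage ht).sub (hβ.memLp t ht)

theorem integral_expAverage_mul (hβ : IsIntegratedWhiteNoise β c P) {a t : ℝ} (ht : 0 ≤ t)
    {Z : Ω → ℝ} (hZ : MemLp Z 2 P) :
    ∫ ω, expAverage a (fun s => β s ω) t * Z ω ∂P
      = expAverage a (fun s => ∫ ω, β s ω * Z ω ∂P) t :=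
  hβ.integral_intervalIntegral_mul ht (by fun_prop) hZ

/-- The covariance of two Ornstein–Uhlenbeck noise terms with rates `a` and `b`, driven by noises
with joint covariance `κ min(s, t)`. -/
theorem integral_expAverage_sub_mul (hβ : IsIntegratedWhiteNoise β c P)
    (hγ : IsIntegratedWhiteNoise γ d P) {κ : ℝ}
    (h : ∀ s t, 0 ≤ s → 0 ≤ t → ∫ ω, β s ω * γ t ω ∂P = κ * min s t)
    {a b t : ℝ} (ha : 0 < a) (hb : 0 < b) (ht : 0 ≤ t) :
    ∫ ω, (expAverage a (fun s => β s ω) t - β t ω) *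
        (expAverage b (fun s => γ s ω) t - γ t ω) ∂P
      = κ * (1 - Real.exp (-(a + b) * t)) / (a + b) := by
  have hA := hβ.memLp_expAverage (a := a) ht
  have hB := hγ.memLp_expAverage (a := b) ht
  have hbt := hβ.memLp t ht
  have hct := hγ.memLp t ht
  have hcongr : ∀ (a : ℝ) (f g : ℝ → ℝ), (∀ s, 0 ≤ s → s ≤ t → f s = κ * g s) →
      expAverage a f t = κ * expAverage a g t := by
    intro a f g hfg
    unfold expAverage
    rw [← intervalIntegral.integral_const_mul]
    apply intervalIntegral.integral_congr
    intro s hs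
    rw [Set.uIcc_of_le ht] at hs
    simp only [hfg s hs.1 hs.2]; ring
  have e1 : ∀ r, 0 ≤ r → ∫ ω, expAverage a (fun s => β s ω) t * γ r ω ∂P
      = κ * expAverage a (fun s => min s r) t := by
    intro r hr
    rw [hβ.integral_expAverage_mul ht (hγ.memLp r hr)]
    exact hcongr _ _ _ fun s hs _ => h s r hs hr
  have e2 : ∫ ω, β t ω * expAverage b (fun s => γ s ω) t ∂P
      = κ * expAverage b (fun s => min s t) t := by
    simp_rw [mul_comm (β t _)]
    rw [hγ.integral_expAverage_mul ht hbt]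
    refine hcongr _ _ _ fun s hs _ => ?_
    simp_rw [mul_comm (γ s _)]
    rw [h t s ht hs, min_comm]
  have e3 : ∫ ω, expAverage a (fun s => β s ω) t * expAverage b (fun s => γ s ω) t ∂P
      = κ * expAverage b (fun r => expAverage a (fun s => min s r) t) t := by
    simp_rw [mul_comm (expAverage a _ _)]
    rw [hγ.integral_expAverage_mul ht hA]
    refine hcongr _ _ _ fun r hr _ => ?_
    simp_rw [mul_comm (γ r _)]
    exact e1 r hr
  have hsplit : ∀ ω, (expAverage a (fun s => β s ω) t - β t ω) *
        (expAverage b (fun s => γ s ω) t - γ t ω)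
      = expAverage a (fun s => β s ω) t * expAverage b (fun s => γ s ω) t
        + β t ω * γ t ω - (expAverage a (fun s => β s ω) t * γ t ω
        + β t ω * expAverage b (fun s => γ s ω) t) := fun ω => by ring
  simp_rw [hsplit]
  have i1 := hA.integrable_mul hB
  have i2 := hA.integrable_mul hct
  have i3 := hbt.integrable_mul hB
  have i4 := hbt.integrable_mul hct
  simp only [Pi.mul_def] at i1 i2 i3 i4
  rw [integral_sub (i1.fun_add i4) (i2.fun_add i3), integral_add i1 i4, integral_add i2 i3,
    e1 t ht, e2, e3, h t t ht ht, expAverage_min ha.ne' ht le_rfl, expAverage_min hb.ne' ht le_rfl,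
    expAverage_expAverage_min ha hb ht]
  simp only [sub_self, mul_zero, Real.exp_zero, min_self]
  field_simp; ring

/-- The covariances of relaxing modes converge to their stationary values, whatever the joint law
of the initial values and the noise. -/
theorem tendsto_integral_mul (hβ : IsIntegratedWhiteNoise β c P)
    (hγ : IsIntegratedWhiteNoise γ d P) {κ : ℝ}
    (h : ∀ s t, 0 ≤ s → 0 ≤ t → ∫ ω, β s ω * γ t ω ∂P = κ * min s t)
    {a b : ℝ} (ha : 0 < a) (hb : 0 < b) {X Y : Ω → ℝ} (hX : MemLp X 2 P) (hY : MemLp Y 2 P) :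
    Tendsto (fun t => ∫ ω,
      (Real.exp (-a * t) * X ω + (expAverage a (fun s => β s ω) t - β t ω)) *
      (Real.exp (-b * t) * Y ω + (expAverage b (fun s => γ s ω) t - γ t ω)) ∂P)
      atTop (𝓝 (κ / (a + b))) := by
  have hexp : ∀ a : ℝ, 0 < a → Tendsto (fun t : ℝ => Real.exp (-a * t)) atTop (𝓝 0) := fun a ha =>
    Real.tendsto_exp_atBot.comp (tendsto_id.const_mul_atTop_of_neg (neg_neg_iff_pos.2 ha))
  have hbound : ∀ {β : ℝ → Ω → ℝ} {c a : ℝ} {Z : Ω → ℝ}, IsIntegratedWhiteNoise β c P → 0 < a →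
      MemLp Z 2 P → ∀ t, 0 ≤ t →
      |∫ ω, Z ω * (expAverage a (fun s => β s ω) t - β t ω) ∂P|
        ≤ ((∫ ω, Z ω ^ 2 ∂P) + |c| / (a + a)) / 2 := by
    intro β c a Z hβ ha hZ t ht
    have hN := hβ.memLp_expAverage_sub (a := a) ht
    have hcov := hβ.integral_expAverage_sub_mul hβ hβ.autocorrelation ha ha ht
    have hN2 : ∫ ω, (expAverage a (fun s => β s ω) t - β t ω) ^ 2 ∂P ≤ |c| / (a + a) := by
      simp_rw [sq]
      rw [hcov]
      have h1 : 0 ≤ 1 - Real.exp (-(a + a) * t) := by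
        have : Real.exp (-(a + a) * t) ≤ 1 := Real.exp_le_one_iff.2 (by nlinarith)
        linarith
      gcongr
      have h2 := Real.exp_pos (-(a + a) * t)
      nlinarith [le_abs_self c, abs_nonneg c, mul_nonneg (abs_nonneg c) h2.le,
        mul_le_mul_of_nonneg_right (le_abs_self c) h1]
    have hle : |∫ ω, Z ω * (expAverage a (fun s => β s ω) t - β t ω) ∂P|
        ≤ ((∫ ω, Z ω ^ 2 ∂P)
          + ∫ ω, (expAverage a (fun s => β s ω) t - β t ω) ^ 2 ∂P) / 2 := by
      rw [← integral_add hZ.integrable_sq hN.integrable_sq, ← integral_div]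
      refine (abs_integral_le_integral_abs).trans (integral_mono
        (hZ.integrable_mul hN).abs ((hZ.integrable_sq.add hN.integrable_sq).div_const 2) ?_)
      intro ω
      simp only [abs_mul]
      set N := expAverage a (fun s => β s ω) t - β t ω
      nlinarith [sq_nonneg (|Z ω| - |N|), sq_abs (Z ω), sq_abs N]
    linarith
  have hzero : ∀ {β : ℝ → Ω → ℝ} {c a b : ℝ} {Z : Ω → ℝ}, IsIntegratedWhiteNoise β c P → 0 < a →
      0 < b → MemLp Z 2 P →
      Tendsto (fun t => Real.exp (-b * t) *
        ∫ ω, Z ω * (expAverage a (fun s => β s ω) t - β t ω) ∂P) atTop (𝓝 0) := by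
    intro β c a b Z hβ ha hb hZ
    refine squeeze_zero_norm' ?_ 
      ((zero_mul (((∫ ω, Z ω ^ 2 ∂P) + |c| / (a + a)) / 2)) ▸ (hexp b hb).mul_const
      (((∫ ω, Z ω ^ 2 ∂P) + |c| / (a + a)) / 2))
    filter_upwards [eventually_ge_atTop 0] with t ht
    rw [norm_mul, Real.norm_of_nonneg (Real.exp_pos _).le]
    exact mul_le_mul_of_nonneg_left (hbound hβ ha hZ t ht) (Real.exp_pos _).le
  have hlim : Tendsto (fun t => Real.exp (-a * t) * Real.exp (-b * t) * (∫ ω, X ω * Y ω ∂P)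
      + Real.exp (-a * t) * (∫ ω, X ω * (expAverage b (fun s => γ s ω) t - γ t ω) ∂P)
      + Real.exp (-b * t) * (∫ ω, Y ω * (expAverage a (fun s => β s ω) t - β t ω) ∂P)
      + κ * (1 - Real.exp (-(a + b) * t)) / (a + b)) atTop (𝓝 (κ / (a + b))) := by
    have := ((((hexp a ha).mul (hexp b hb)).mul_const (∫ ω, X ω * Y ω ∂P)).add
      (hzero hγ hb ha hX)).add (hzero hβ ha hb hY)
    have h4 := (((hexp (a + b) (by positivity)).const_sub 1).const_mul κ).div_const (a + b)
    simpa using this.add h4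
  refine hlim.congr' ?_
  filter_upwards [eventually_ge_atTop 0] with t ht
  have hN := hβ.memLp_expAverage_sub (a := a) ht
  have hM := hγ.memLp_expAverage_sub (a := b) ht
  rw [← hβ.integral_expAverage_sub_mul hγ h ha hb ht, ← integral_const_mul, ← integral_const_mul,
    ← integral_const_mul]
  have i1 := (hX.integrable_mul hY).const_mul (Real.exp (-a * t) * Real.exp (-b * t))
  have i2 := (hX.integrable_mul hM).const_mul (Real.exp (-a * t))
  have i3 := (hY.integrable_mul hN).const_mul (Real.exp (-b * t))
  have i4 := hN.integrable_mul hM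
  simp only [Pi.mul_apply, Pi.mul_def] at i1 i2 i3 i4
  rw [← integral_add i1 i2, ← integral_add (i1.fun_add i2) i3,
    ← integral_add ((i1.fun_add i2).fun_add i3) i4]
  congr 1; ext ω; ring

end IsIntegratedWhiteNoise

/-! ### The grounded Laplacian -/

section Graph

variable {V : Type*} [Fintype V] {G : SimpleGraph V} [DecidableRel G.Adj]
  {ν : V → V → ℝ} {S : Finset V}

/-- Oriented edges are pairs of a vertex and one of its neighbors. -/
theorem sum_dart (F : V → V → ℝ) :
    ∑ l : G.Dart, F l.fst l.snd = ∑ i, ∑ j ∈ G.neighborFinset i, F i j := by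
  rw [Finset.sum_sigma']
  refine Finset.sum_bij' (fun l _ => ⟨l.fst, l.snd⟩)
    (fun p hp => ⟨(p.1, p.2), by simpa using hp⟩) ?_ ?_ ?_ ?_ ?_ <;> simp

theorem weightedDegree_pos (hG : G.Connected) (hν : ∀ i j, G.Adj i j → 0 < ν i j)
    (hS : S.Nonempty) {i : V} (hi : i ∉ S) : 0 < weightedDegree G ν i := by
  obtain ⟨s, hs⟩ := hS
  obtain ⟨p⟩ := hG.preconnected i s
  cases p with
  | nil => exact absurd hs hi
  | @cons _ j _ h _ =>
    exact Finset.sum_pos (fun j hj => inv_pos.2 (hν _ _ (by simpa using hj)))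
      ⟨j, by simpa using h⟩

variable [DecidableEq V]

theorem sum_mem_add_sum_notMem (S : Finset V) (f : V → ℝ) :
    ∑ i : {i // i ∈ S}, f i + ∑ i : {i // i ∉ S}, f i = ∑ i, f i := by
  convert Fintype.sum_subtype_add_sum_subtype (· ∈ S) f

theorem laplacian_of_adj {i j : V} (h : G.Adj i j) : laplacian G ν i j = -(ν i j)⁻¹ := by
  simp [laplacian, h, h.ne]

theorem laplacian_mulVec (z : V → ℝ) (i : V) :
    (laplacian G ν *ᵥ z) i = ∑ j ∈ G.neighborFinset i, (ν i j)⁻¹ * (z i - z j) := by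
  have hi : i ∉ G.neighborFinset i := by simp
  have hsub : insert i (G.neighborFinset i) ⊆ Finset.univ := Finset.subset_univ _
  rw [Matrix.mulVec, dotProduct, ← Finset.sum_subset hsub, Finset.sum_insert hi]
  · have : ∑ j ∈ G.neighborFinset i, laplacian G ν i j * z j
        = ∑ j ∈ G.neighborFinset i, -(ν i j)⁻¹ * z j :=
      Finset.sum_congr rfl fun j hj => by rw [laplacian_of_adj (by simpa using hj)]
    rw [this]
    simp only [laplacian, Matrix.of_apply, if_true, weightedDegree, Finset.sum_mul,
      ← Finset.sum_add_distrib]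
    exact Finset.sum_congr rfl fun j _ => by ring
  · intro j _ hj
    simp only [Finset.mem_insert, SimpleGraph.mem_neighborFinset, not_or] at hj
    simp [laplacian, Ne.symm hj.1, hj.2]

theorem laplacian_mulVec_follower (z : V → ℝ) (i : {i // i ∉ S}) :
    (laplacian G ν *ᵥ z) i
      = (Lff G ν S *ᵥ fun j => z j) i + (Lfl G ν S *ᵥ fun j => z j) i := by
  simp only [Matrix.mulVec, dotProduct, Lff, Lfl, Matrix.submatrix_apply]
  rw [add_comm]
  exact (sum_mem_add_sum_notMem S fun j => laplacian G ν i j * z j).symm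

theorem edgeMatrix_mulVec (r : V → V → ℝ) (i : {i // i ∉ S}) :
    (edgeMatrix G ν S *ᵥ fun l : G.Dart => r l.fst l.snd) i
      = -∑ j ∈ G.neighborFinset i.val, (ν i j)⁻¹ * r i j := by
  simp only [Matrix.mulVec, dotProduct, edgeMatrix, Matrix.of_apply]
  rw [sum_dart fun a b => (if a = i.val then laplacian G ν a b else 0) * r a b,
    Finset.sum_eq_single i.val (by simp +contextual) (by simp), ← Finset.sum_neg_distrib]
  refine Finset.sum_congr rfl fun j hj => ?_
  rw [if_pos rfl, laplacian_of_adj (by simpa using hj)]; ring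

theorem laplacian_isSymm (hν : ∀ i j, G.Adj i j → ν i j = ν j i) : (laplacian G ν).IsSymm := by
  ext i j
  simp only [Matrix.transpose_apply, laplacian, Matrix.of_apply]
  rcases eq_or_ne i j with rfl | hij
  · simp
  · simp only [hij, hij.symm, if_false, G.adj_comm j i]
    split_ifs with h
    · rw [hν i j h]
    · rfl

/-- The Dirichlet energy: each edge contributes `ν_ij⁻¹ (z_i - z_j)²`, once per orientation. -/
theorem two_mul_dotProduct_laplacian_mulVec (hν : ∀ i j, G.Adj i j → ν i j = ν j i)
    (z : V → ℝ) :
    2 * (z ⬝ᵥ laplacian G ν *ᵥ z)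
      = ∑ i, ∑ j ∈ G.neighborFinset i, (ν i j)⁻¹ * (z i - z j) ^ 2 := by
  have hsum : ∀ F : V → V → ℝ, ∑ i, ∑ j ∈ G.neighborFinset i, F i j
      = ∑ i, ∑ j, if G.Adj i j then F i j else 0 := fun F => by
    refine Finset.sum_congr rfl fun i _ => ?_
    rw [← Finset.sum_filter]
    exact Finset.sum_congr (by ext; simp) fun _ _ => rfl
  have h1 : z ⬝ᵥ laplacian G ν *ᵥ z
      = ∑ i, ∑ j ∈ G.neighborFinset i, (ν i j)⁻¹ * (z i * (z i - z j)) := by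
    simp only [dotProduct, laplacian_mulVec, Finset.mul_sum]
    exact Finset.sum_congr rfl fun i _ => Finset.sum_congr rfl fun j _ => by ring
  have h2 : z ⬝ᵥ laplacian G ν *ᵥ z
      = ∑ i, ∑ j ∈ G.neighborFinset i, (ν i j)⁻¹ * (z j * (z j - z i)) := by
    rw [h1, hsum, hsum, Finset.sum_comm]
    refine Finset.sum_congr rfl fun i _ => Finset.sum_congr rfl fun j _ => ?_
    simp only [G.adj_comm j i]
    split_ifs with h
    · rw [hν i j h]
    · rfl
  rw [two_mul]
  nth_rewrite 1 [h1]
  rw [h2, ← Finset.sum_add_distrib]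
  refine Finset.sum_congr rfl fun i _ => ?_
  rw [← Finset.sum_add_distrib]
  exact Finset.sum_congr rfl fun j _ => by ring

theorem Lff_posDef (hG : G.Connected) (hν_pos : ∀ i j, G.Adj i j → 0 < ν i j)
    (hν_symm : ∀ i j, G.Adj i j → ν i j = ν j i) (hS : S.Nonempty) :
    (Lff G ν S).PosDef := by
  have hsymm : (Lff G ν S).IsSymm := (laplacian_isSymm hν_symm).submatrix _
  refine Matrix.PosDef.of_dotProduct_mulVec_pos
    ((Matrix.conjTranspose_eq_transpose_of_trivial _).trans hsymm) fun {y} hy => ?_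
  -- extend `y` by zero on the leaders
  set z : V → ℝ := fun i => if h : i ∉ S then y ⟨i, h⟩ else 0 with hz
  have hzS : ∀ i ∈ S, z i = 0 := fun i hi => by simp [hz, hi]
  have hzf : ∀ i : {i // i ∉ S}, z i = y i := fun i => by simp [hz, i.2]
  have henergy : y ⬝ᵥ Lff G ν S *ᵥ y = z ⬝ᵥ laplacian G ν *ᵥ z := by
    rw [dotProduct, dotProduct, ← sum_mem_add_sum_notMem S]
    have h0 : ∑ i : {i // i ∈ S}, z i * (laplacian G ν *ᵥ z) i = 0 :=
      Finset.sum_eq_zero fun i _ => by rw [hzS i i.2, zero_mul]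
    rw [h0, zero_add]
    refine Finset.sum_congr rfl fun i _ => ?_
    rw [laplacian_mulVec_follower, hzf]
    simp only [hzf]
    have : (fun j : {i // i ∈ S} => z j) = 0 := funext fun j => hzS j j.2
    rw [this]; simp
  rw [star_trivial, henergy]
  have hE := two_mul_dotProduct_laplacian_mulVec hν_symm z
  have hterm : ∀ i, ∀ j ∈ G.neighborFinset i, 0 ≤ (ν i j)⁻¹ * (z i - z j) ^ 2 := fun i j hj =>
    mul_nonneg (inv_pos.2 (hν_pos i j (by simpa using hj))).le (sq_nonneg _)
  by_contra! hle
  have hsum0 : ∑ i, ∑ j ∈ G.neighborFinset i, (ν i j)⁻¹ * (z i - z j) ^ 2 = 0 :=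
    le_antisymm (by linarith) (Finset.sum_nonneg fun i _ => Finset.sum_nonneg (hterm i))
  -- zero energy makes `z` constant along edges, hence equal to its value `0` at a leader
  have hadj : ∀ i j, G.Adj i j → z i = z j := by
    intro i j h
    have hi := (Finset.sum_eq_zero_iff_of_nonneg
      fun i _ => Finset.sum_nonneg (hterm i)).1 hsum0 i (Finset.mem_univ i)
    have hij := (Finset.sum_eq_zero_iff_of_nonneg (hterm i)).1 hi j (by simpa using h)
    have := (mul_eq_zero.1 hij).resolve_left (inv_pos.2 (hν_pos i j h)).ne'
    exact sub_eq_zero.1 (pow_eq_zero_iff two_ne_zero |>.1 this)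
  obtain ⟨s, hs⟩ := hS
  apply hy
  ext i
  obtain ⟨p⟩ := hG.preconnected i.val s
  have hwalk : ∀ {a b : V}, G.Walk a b → z a = z b := by
    intro a b p
    induction p with
    | nil => rfl
    | cons h _ ih => exact (hadj _ _ h).trans ih
  rw [← hzf, hwalk p, hzS s hs]; rfl

/-- The weighted mismatch of the edge measurements at a follower is linear in the error. -/
theorem sum_mismatch_eq (hdet : IsUnit (Lff G ν S).det) (r : V → V → ℝ) (xl : {i // i ∈ S} → ℝ)
    {z : V → ℝ} (hz : ∀ l : {i // i ∈ S}, z l = xl l) (i : {i // i ∉ S}) :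
    ∑ j ∈ G.neighborFinset i.val, (ν i j)⁻¹ * (z i - z j - r i j)
      = (Lff G ν S *ᵥ fun j => z j - desiredState G ν S r xl j) i := by
  have h1 : (fun j : {i // i ∉ S} => z j - desiredState G ν S r xl j)
      = (fun j : {i // i ∉ S} => z j) - desiredState G ν S r xl := rfl
  have h2 : Lff G ν S *ᵥ desiredState G ν S r xl
      = -(Lfl G ν S *ᵥ xl + edgeMatrix G ν S *ᵥ fun l : G.Dart => r l.fst l.snd) := by
    rw [desiredState, Matrix.mulVec_neg, Matrix.mulVec_mulVec, Matrix.mul_nonsing_inv _ hdet,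
      Matrix.one_mulVec]
  have h3 := laplacian_mulVec_follower (G := G) (ν := ν) z i
  rw [laplacian_mulVec, show (fun j : {i // i ∈ S} => z j) = xl from funext hz] at h3
  rw [h1, Matrix.mulVec_sub, h2]
  simp only [Pi.sub_apply, Pi.neg_apply, Pi.add_apply, edgeMatrix_mulVec]
  simp only [mul_sub (_⁻¹) (_ - _) (r _ _), Finset.sum_sub_distrib, h3]
  ring

/-- Exact data have no mismatch, so their deviation from `x_f*` lies in the kernel of `L_ff`. -/
theorem eq_desiredState (hdet : IsUnit (Lff G ν S).det) (r : V → V → ℝ) (xl : {i // i ∈ S} → ℝ)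
    {z : V → ℝ} (hr : ∀ i j, G.Adj i j → z i - z j = r i j)
    (hz : ∀ l : {i // i ∈ S}, z l = xl l) (i : {i // i ∉ S}) :
    z i = desiredState G ν S r xl i := by
  have h0 : Lff G ν S *ᵥ (fun j => z j - desiredState G ν S r xl j) = 0 := by
    ext i
    rw [← sum_mismatch_eq hdet r xl hz i]
    exact Finset.sum_eq_zero fun j hj => by rw [hr i j (by simpa using hj)]; simp
  have := Matrix.eq_zero_of_mulVec_eq_zero hdet.ne_zero h0
  exact sub_eq_zero.1 (congrFun this i)

end Graph

/-! ### Simultaneous diagonalization -/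

theorem mul_diagonal_mul_apply {ι κ n : Type*} [Fintype n] [DecidableEq n] (A : Matrix ι n ℝ)
    (d : n → ℝ) (B : Matrix n κ ℝ) (i : ι) (k : κ) :
    (A * Matrix.diagonal d * B) i k = ∑ l, A i l * d l * B l k := by
  rw [Matrix.mul_apply]
  simp only [Matrix.mul_diagonal]

/-- Coordinates in which the drift `D⁻¹ K` is diagonal and noise of covariance `D⁻¹` is white, with
`K` positive definite and `D` diagonal. In terms of an orthonormal eigenbasis `U` of
`D^{-1/2} K D^{-1/2}`, they are `T = Uᵀ D^{1/2}`, with inverse `R = D^{-1/2} U`. -/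
theorem exists_diagonalization {n : Type*} [Fintype n] [DecidableEq n] {K : Matrix n n ℝ}
    (hK : K.PosDef) {d : n → ℝ} (hd : ∀ i, 0 < d i) :
    ∃ (a : n → ℝ) (T R : Matrix n n ℝ), (∀ k, 0 < a k) ∧ R * T = 1 ∧
      T * Matrix.diagonal d⁻¹ * K = Matrix.diagonal a * T ∧
      T * Matrix.diagonal d⁻¹ * Tᵀ = 1 ∧ R * Matrix.diagonal a⁻¹ * Rᵀ = K⁻¹ := by
  set s : Matrix n n ℝ := Matrix.diagonal fun i => (√(d i))⁻¹ with hs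
  set s' : Matrix n n ℝ := Matrix.diagonal fun i => √(d i) with hs'
  have hsq : ∀ i, √(d i) ≠ 0 := fun i => (Real.sqrt_pos.2 (hd i)).ne'
  have hss' : s * s' = 1 := by simp [hs, hs', Matrix.diagonal_mul_diagonal, hsq]
  have hs's : s' * s = 1 := by simp [hs, hs', Matrix.diagonal_mul_diagonal, hsq]
  have hss : Matrix.diagonal d⁻¹ = s * s := by
    rw [hs, Matrix.diagonal_mul_diagonal]
    congr 1; ext i
    rw [Pi.inv_apply, ← mul_inv, Real.mul_self_sqrt (hd i).le]
  have hsT : sᵀ = s := Matrix.diagonal_transpose _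
  have hs'T : s'ᵀ = s' := Matrix.diagonal_transpose _
  have hM : (s * K * s).PosDef := by
    have hu : IsUnit s := IsUnit.of_mul_eq_one _ hss'
    have h := (Matrix.IsUnit.posDef_star_right_conjugate_iff (x := K) hu).2 hK
    rwa [Matrix.star_eq_conjTranspose, Matrix.conjTranspose_eq_transpose_of_trivial, hsT] at h
  set U : Matrix n n ℝ := hM.isHermitian.eigenvectorUnitary.1 with hU
  set a := hM.isHermitian.eigenvalues with ha
  have hstar : star U = Uᵀ := by
    rw [Matrix.star_eq_conjTranspose, Matrix.conjTranspose_eq_transpose_of_trivial]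
  have hUU : Uᵀ * U = 1 := hstar ▸ Unitary.coe_star_mul_self hM.isHermitian.eigenvectorUnitary
  have hUU' : U * Uᵀ = 1 := hstar ▸ Unitary.coe_mul_star_self hM.isHermitian.eigenvectorUnitary
  have hspec : s * K * s = U * Matrix.diagonal a * Uᵀ := by
    have h := hM.isHermitian.spectral_theorem
    rw [Unitary.conjStarAlgAut_apply] at h
    rw [← hstar]
    exact h
  have hapos : ∀ k, 0 < a k := hM.eigenvalues_pos
  have hUs : Uᵀ * (s * K) = Matrix.diagonal a * (Uᵀ * s') := by
    calc Uᵀ * (s * K) = Uᵀ * (s * K * s) * s' := by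
          simp only [Matrix.mul_assoc, hss', Matrix.mul_one]
      _ = _ := by
          rw [hspec]; simp only [← Matrix.mul_assoc, hUU, Matrix.one_mul]
  refine ⟨a, Uᵀ * s', s * U, hapos, ?_, ?_, ?_, ?_⟩
  · rw [Matrix.mul_assoc, ← Matrix.mul_assoc U, hUU', Matrix.one_mul, hss']
  · rw [hss, ← hUs]
    simp only [Matrix.mul_assoc]
    rw [← Matrix.mul_assoc s' s, hs's, Matrix.one_mul]
  · rw [hss, Matrix.transpose_mul, Matrix.transpose_transpose, hs'T]
    simp only [Matrix.mul_assoc]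
    rw [← Matrix.mul_assoc s' s, hs's, Matrix.one_mul, ← Matrix.mul_assoc s s', hss',
      Matrix.one_mul, hUU]
  · refine (Matrix.inv_eq_left_inv ?_).symm
    have haa : Matrix.diagonal a⁻¹ * Matrix.diagonal a = 1 := by
      rw [Matrix.diagonal_mul_diagonal, ← Matrix.diagonal_one]
      congr 1; ext k
      exact inv_mul_cancel₀ (hapos k).ne'
    rw [Matrix.transpose_mul, hsT]
    calc s * U * Matrix.diagonal a⁻¹ * (Uᵀ * s) * K
        = s * U * Matrix.diagonal a⁻¹ * (Uᵀ * (s * K)) := by simp only [Matrix.mul_assoc]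
      _ = s * U * (Matrix.diagonal a⁻¹ * Matrix.diagonal a) * (Uᵀ * s') := by
          rw [hUs]; simp only [Matrix.mul_assoc]
      _ = s * (U * Uᵀ) * s' := by rw [haa]; simp only [Matrix.mul_assoc, Matrix.one_mul]
      _ = 1 := by rw [hUU', Matrix.mul_one, hss']

/-! ### Families of correlated noises -/

section NoiseFamily

variable {Ω : Type*} [MeasurableSpace Ω] {P : Measure Ω}

/-- `β` is a finite family of integrated white noises with intensity matrix `Γ`, that is,
`E(β_i(s) β_j(t)) = Γ_ij min(s, t)`. -/
structure IsNoiseFamily {ι : Type*} (β : ι → ℝ → Ω → ℝ) (Γ : Matrix ι ι ℝ) (P : Measure Ω) :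
    Prop where
  noise : ∀ i, IsIntegratedWhiteNoise (β i) (Γ i i) P
  covariance : ∀ i j s t, 0 ≤ s → 0 ≤ t → ∫ ω, β i s ω * β j t ω ∂P = Γ i j * min s t

theorem IsNoiseFamily.linearCombination {ι κ : Type*} [Fintype ι] {β : ι → ℝ → Ω → ℝ}
    {Γ : Matrix ι ι ℝ} (h : IsNoiseFamily β Γ P) [IsFiniteMeasure P] (M : Matrix κ ι ℝ) :
    IsNoiseFamily (fun k t ω => ∑ i, M k i * β i t ω) (M * Γ * Mᵀ) P := by
  have hcov : ∀ k l s t, 0 ≤ s → 0 ≤ t →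
      ∫ ω, (∑ i, M k i * β i s ω) * (∑ j, M l j * β j t ω) ∂P = (M * Γ * Mᵀ) k l * min s t := by
    intro k l s t hs ht
    have hint : ∀ i j, Integrable (fun ω => M k i * β i s ω * (M l j * β j t ω)) P := fun i j =>
      (((h.noise i).memLp s hs).const_mul _).integrable_mul (((h.noise j).memLp t ht).const_mul _)
    simp_rw [Finset.sum_mul_sum]
    rw [integral_finsetSum _ fun i _ => integrable_finsetSum _ fun j _ => hint i j]
    simp_rw [integral_finsetSum Finset.univ fun j _ => hint _ j]
    have : ∀ i j, ∫ ω, M k i * β i s ω * (M l j * β j t ω) ∂P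
        = M k i * Γ i j * M l j * min s t := by
      intro i j
      rw [show M k i * Γ i j * M l j * min s t = M k i * M l j * (Γ i j * min s t) by ring,
        ← h.covariance i j s t hs ht, ← integral_const_mul]
      congr 1; ext ω; ring
    simp_rw [this, Matrix.mul_apply, Matrix.transpose_apply, Finset.sum_mul]
    exact Finset.sum_comm
  refine ⟨fun k => ⟨?_, fun t ht => ?_, fun t ht => ?_, hcov k k⟩, hcov⟩
  · have : Function.uncurry (fun t ω => ∑ i, M k i * β i t ω)
        = fun p => ∑ i, M k i * Function.uncurry (β i) p := by ext ⟨t, ω⟩; rfl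
    rw [this]
    exact Finset.aestronglyMeasurable_fun_sum _ fun i _ =>
      (h.noise i).aestronglyMeasurable.const_mul _
  · exact memLp_finsetSum _ fun i _ => ((h.noise i).memLp t ht).const_mul _
  · rw [integral_finsetSum _ fun i _ =>
      (((h.noise i).memLp t ht).const_mul (M k i)).integrable one_le_two]
    exact Finset.sum_eq_zero fun i _ => by
      rw [integral_const_mul, (h.noise i).mean_zero t ht, mul_zero]

/-- Independent noises are uncorrelated. -/
theorem isNoiseFamily_of_iIndepFun {ι : Type*} [DecidableEq ι] {β : ι → ℝ → Ω → ℝ} {c : ι → ℝ}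
    (hβ : ∀ i, IsIntegratedWhiteNoise (β i) (c i) P)
    (hindep : iIndepFun (fun i (ω : Ω) (t : ℝ≥0) => β i t ω) P) :
    IsNoiseFamily β (Matrix.diagonal c) P := by
  refine ⟨fun i => by simpa using hβ i, fun i j s t hs ht => ?_⟩
  rcases eq_or_ne i j with rfl | hij
  · simpa using (hβ i).autocorrelation s t hs ht
  · have h := (hindep.indepFun hij).comp (measurable_pi_apply (⟨s, hs⟩ : ℝ≥0))
      (measurable_pi_apply (⟨t, ht⟩ : ℝ≥0))
    have h' := h.integral_mul_eq_mul_integral ((hβ i).memLp s hs).1 ((hβ j).memLp t ht).1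
    rw [Matrix.diagonal_apply_ne _ hij, zero_mul]
    refine h'.trans ?_
    have : ∫ ω, β i s ω ∂P = 0 := (hβ i).mean_zero s hs
    change (∫ ω, β i s ω ∂P) * _ = 0
    rw [this, zero_mul]

end NoiseFamily

/-! ### The error in modal coordinates -/

/-- A system `y' = -D⁻¹ K y - w'` in integrated form, in coordinates `T y` for which `T D⁻¹ K` is
`diag(a) T`: each coordinate solves a scalar relaxation equation. -/
theorem modal_solution {n : Type*} [Fintype n] [DecidableEq n] {K T : Matrix n n ℝ}
    {d a : n → ℝ} (hT : T * Matrix.diagonal d⁻¹ * K = Matrix.diagonal a * T)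
    {y w : n → ℝ → ℝ} (hint : ∀ i t, 0 ≤ t → IntervalIntegrable (y i) volume 0 t)
    (hy : ∀ i t, 0 ≤ t → y i t
      = y i 0 - (∫ s in (0 : ℝ)..t, (d i)⁻¹ * (K *ᵥ fun j => y j s) i) - w i t)
    (k : n) {t : ℝ} (ht : 0 ≤ t) :
    ∑ i, T k i * y i t = Real.exp (-a k * t) * ∑ i, T k i * y i 0
      + (expAverage (a k) (fun s => ∑ i, T k i * w i s) t - ∑ i, T k i * w i t) := by
  have hKint : ∀ i s, 0 ≤ s →
      IntervalIntegrable (fun r => (d i)⁻¹ * (K *ᵥ fun j => y j r) i) volume 0 s := by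
    intro i s hs
    simp only [Matrix.mulVec, dotProduct]
    refine IntervalIntegrable.const_mul ?_ _
    simpa only [Finset.sum_fn] using
      IntervalIntegrable.sum Finset.univ fun j _ => (hint j s hs).const_mul (K i j)
  have hTint : IntervalIntegrable (fun t => ∑ i, T k i * y i t) volume 0 t := by
    simpa only [Finset.sum_fn] using
      IntervalIntegrable.sum Finset.univ fun i _ => (hint i t ht).const_mul (T k i)
  refine eq_exp_mul_add_expAverage_sub ht hTint fun s hs => ?_
  have hdrift : ∀ r, ∑ i, T k i * ((d i)⁻¹ * (K *ᵥ fun j => y j r) i)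
      = a k * ∑ i, T k i * y i r := by
    intro r
    have h := congrFun (congrArg (fun M => M *ᵥ fun j => y j r) hT) k
    simp only [Matrix.mul_assoc T, ← Matrix.mulVec_mulVec, Matrix.mulVec_diagonal] at h
    rw [Matrix.mulVec, dotProduct] at h
    simp only [Matrix.mulVec_diagonal, Pi.inv_apply] at h
    exact h
  have hsum : a k * ∫ r in (0 : ℝ)..s, ∑ i, T k i * y i r
      = ∑ i, T k i * ∫ r in (0 : ℝ)..s, (d i)⁻¹ * (K *ᵥ fun j => y j r) i := by
    simp_rw [← intervalIntegral.integral_const_mul, ← hdrift]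
    exact intervalIntegral.integral_finsetSum fun i _ => (hKint i s hs).const_mul _
  rw [hsum, ← Finset.sum_sub_distrib, ← Finset.sum_sub_distrib]
  exact Finset.sum_congr rfl fun i _ => by rw [hy i s hs]; ring

section Moments

variable {Ω : Type*} [MeasurableSpace Ω] {P : Measure Ω} [IsProbabilityMeasure P]

/-- Mean square of a linear image of relaxing modes driven by orthonormal white noise. -/
theorem tendsto_integral_sum_sq {n κ : Type*} [Fintype n] [DecidableEq n] [Fintype κ]
    {m : n → ℝ → Ω → ℝ} (hm : IsNoiseFamily m 1 P) {a : n → ℝ} (ha : ∀ k, 0 < a k)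
    {X : n → Ω → ℝ} (hX : ∀ k, MemLp (X k) 2 P) (R : Matrix κ n ℝ) {e : ℝ → Ω → ℝ}
    (he : ∀ t, 0 ≤ t → ∀ᵐ ω ∂P, e t ω = ∑ i, (∑ k, R i k * (Real.exp (-a k * t) * X k ω
      + (expAverage (a k) (fun s => m k s ω) t - m k t ω))) ^ 2) :
    (∀ t, 0 ≤ t → Integrable (e t) P) ∧
    Tendsto (fun t => ∫ ω, e t ω ∂P) atTop
      (𝓝 (1 / 2 * (R * Matrix.diagonal a⁻¹ * Rᵀ).trace)) := by
  set u : n → ℝ → Ω → ℝ := fun k t ω => Real.exp (-a k * t) * X k ω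
      + (expAverage (a k) (fun s => m k s ω) t - m k t ω) with hu
  have hmem : ∀ k t, 0 ≤ t → MemLp (u k t) 2 P := fun k t ht =>
    ((hX k).const_mul _).add ((hm.noise k).memLp_expAverage_sub ht)
  have hint : ∀ k l t, 0 ≤ t → Integrable (fun ω => u k t ω * u l t ω) P := fun k l t ht =>
    (hmem k t ht).integrable_mul (hmem l t ht)
  have hexpand : ∀ t ω, ∑ i, (∑ k, R i k * u k t ω) ^ 2
      = ∑ i, ∑ k, ∑ l, R i k * R i l * (u k t ω * u l t ω) := by
    intro t ω
    refine Finset.sum_congr rfl fun i _ => ?_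
    rw [sq, Finset.sum_mul_sum]
    exact Finset.sum_congr rfl fun k _ => Finset.sum_congr rfl fun l _ => by ring
  have he' : ∀ t, 0 ≤ t →
      e t =ᵐ[P] fun ω => ∑ i, ∑ k, ∑ l, R i k * R i l * (u k t ω * u l t ω) := fun t ht => by
    filter_upwards [he t ht] with ω h
    rw [h, ← hexpand]
  refine ⟨fun t ht => ?_, ?_⟩
  · refine Integrable.congr ?_ (he' t ht).symm
    exact integrable_finsetSum _ fun i _ => integrable_finsetSum _ fun k _ =>
      integrable_finsetSum _ fun l _ => (hint k l t ht).const_mul _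
  · have hlim : Tendsto (fun t => ∑ i, ∑ k, ∑ l, R i k * R i l * ∫ ω, u k t ω * u l t ω ∂P) atTop
        (𝓝 (∑ i, ∑ k, ∑ l, R i k * R i l * ((1 : Matrix n n ℝ) k l / (a k + a l)))) :=
      tendsto_finsetSum _ fun i _ => tendsto_finsetSum _ fun k _ => tendsto_finsetSum _ fun l _ =>
        ((hm.noise k).tendsto_integral_mul (hm.noise l) (hm.covariance k l) (ha k) (ha l)
          (hX k) (hX l)).const_mul _
    have hval : ∑ i, ∑ k, ∑ l, R i k * R i l * ((1 : Matrix n n ℝ) k l / (a k + a l))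
        = 1 / 2 * (R * Matrix.diagonal a⁻¹ * Rᵀ).trace := by
      simp only [Matrix.trace, Matrix.diag, mul_diagonal_mul_apply, Finset.mul_sum,
        Matrix.transpose_apply]
      refine Finset.sum_congr rfl fun i _ => Finset.sum_congr rfl fun k _ => ?_
      rw [Finset.sum_eq_single k (fun l _ hl => by simp [Matrix.one_apply_ne hl.symm]) (by simp),
        Matrix.one_apply_eq, Pi.inv_apply]
      have := (ha k).ne'
      field_simp; ring
    rw [← hval]
    refine hlim.congr' ?_
    filter_upwards [eventually_ge_atTop 0] with t ht
    rw [integral_congr_ae (he' t ht), integral_finsetSum _ fun i _ => integrable_finsetSum _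
      fun k _ => integrable_finsetSum _ fun l _ => (hint k l t ht).const_mul _]
    refine Finset.sum_congr rfl fun i _ => ?_
    rw [integral_finsetSum _ fun k _ => integrable_finsetSum _ fun l _ =>
      (hint k l t ht).const_mul _]
    refine Finset.sum_congr rfl fun k _ => ?_
    rw [integral_finsetSum _ fun l _ => (hint k l t ht).const_mul _]
    exact Finset.sum_congr rfl fun l _ => (integral_const_mul _ _).symm

end Moments

/-! ### The leader-follower system -/

section System

variable {V : Type*} [Fintype V] [DecidableEq V] {G : SimpleGraph V} [DecidableRel G.Adj]
  {ν : V → V → ℝ} {S : Finset V}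

/-- The matrix of best linear unbiased estimator weights, with rows indexed by followers and columns
by oriented edges. -/
noncomputable def weightMatrix (G : SimpleGraph V) [DecidableRel G.Adj] (ν : V → V → ℝ)
    (S : Finset V) : Matrix {i // i ∉ S} G.Dart ℝ :=
  Matrix.of fun i l => if l.fst = i.val then blueWeight G ν l.fst l.snd else 0

theorem sum_weightMatrix_mul (F : V → V → ℝ) (i : {i // i ∉ S}) :
    ∑ l : G.Dart, weightMatrix G ν S i l * F l.fst l.snd
      = ∑ j ∈ G.neighborFinset i.val, blueWeight G ν i j * F i j := by
  simp only [weightMatrix, Matrix.of_apply]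
  rw [sum_dart fun a b => (if a = i.val then blueWeight G ν a b else 0) * F a b,
    Finset.sum_eq_single i.val (by simp +contextual) (by simp)]
  simp

/-- With the best linear unbiased estimator weights, the noise received by follower `i` has
intensity `D_i⁻¹`. -/
theorem weightMatrix_mul_diagonal_mul (hν : ∀ i j, G.Adj i j → 0 < ν i j)
    (hD : ∀ i : {i // i ∉ S}, 0 < weightedDegree G ν i) :
    weightMatrix G ν S * Matrix.diagonal (fun l : G.Dart => ν l.fst l.snd) * (weightMatrix G ν S)ᵀ
      = Matrix.diagonal (fun i : {i // i ∉ S} => weightedDegree G ν i)⁻¹ := by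
  ext i k
  simp only [mul_diagonal_mul_apply, Matrix.transpose_apply, mul_assoc]
  have h := sum_weightMatrix_mul (G := G) (ν := ν)
    (fun a b => ν a b * if a = k.val then blueWeight G ν a b else 0) i
  refine Eq.trans h ?_
  rcases eq_or_ne i k with rfl | hik
  · simp only [if_true, Matrix.diagonal_apply_eq, Pi.inv_apply]
    have hterm : ∀ j ∈ G.neighborFinset i.val,
        blueWeight G ν i j * (ν i j * blueWeight G ν i j)
          = (ν i j)⁻¹ * (weightedDegree G ν i ^ 2)⁻¹ := by
      intro j hj
      have h1 := (hν i j (by simpa using hj)).ne'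
      have h2 := (hD i).ne'
      rw [blueWeight]; field_simp
    rw [Finset.sum_congr rfl hterm, ← Finset.sum_mul]
    change weightedDegree G ν i * _ = _
    have h2 := (hD i).ne'
    field_simp
  · rw [Matrix.diagonal_apply_ne _ hik]
    have : i.val ≠ k.val := fun h => hik (Subtype.ext h)
    simp [this]

theorem squaredError_eq {Ω : Type*} [MeasurableSpace Ω] (r : V → V → ℝ) (xl : {i // i ∈ S} → ℝ)
    (x : V → ℝ → Ω → ℝ) (t : ℝ) (ω : Ω) :
    squaredError G ν S r xl x t ω
      = ∑ i : {i // i ∉ S}, (x i t ω - desiredState G ν S r xl i) ^ 2 := by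
  simp [squaredError, EuclideanSpace.norm_sq_eq]

/-- The error of a solution satisfies `y' = -D⁻¹ L_ff y - w'` in integrated form, where `w`
collects the weighted noises at each follower. -/
theorem IsSolution.ae_error_eq {Ω : Type*} [MeasurableSpace Ω] {P : Measure Ω} {r : V → V → ℝ}
    {xl : {i // i ∈ S} → ℝ} {β : V → V → ℝ → Ω → ℝ} {x : V → ℝ → Ω → ℝ}
    (hx : IsSolution G ν S r xl β x P) (hdet : IsUnit (Lff G ν S).det) :
    ∀ᵐ ω ∂P, ∀ (i : {i // i ∉ S}) (t : ℝ), 0 ≤ t →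
      x i t ω - desiredState G ν S r xl i
        = x i 0 ω - desiredState G ν S r xl i
          - (∫ s in (0 : ℝ)..t, (weightedDegree G ν i)⁻¹
              * (Lff G ν S *ᵥ fun j => x j s ω - desiredState G ν S r xl j) i)
          - ∑ l : G.Dart, weightMatrix G ν S i l * β l.fst l.snd t ω := by
  filter_upwards [hx.leader, hx.follower] with ω hl hf i t ht
  rw [sum_weightMatrix_mul (fun a b => β a b t ω) i, hf i i.2 t ht]
  have hI : ∫ s in (0 : ℝ)..t, ∑ j ∈ G.neighborFinset i.val,
        blueWeight G ν i j * (x i s ω - x j s ω - r i j)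
      = ∫ s in (0 : ℝ)..t, (weightedDegree G ν i)⁻¹
          * (Lff G ν S *ᵥ fun j => x j s ω - desiredState G ν S r xl j) i := by
    apply intervalIntegral.integral_congr
    intro s hs
    rw [Set.uIcc_of_le ht] at hs
    simp only
    rw [← sum_mismatch_eq hdet r xl (z := fun i => x i s ω) (fun l => hl l s hs.1) i,
      Finset.mul_sum]
    exact Finset.sum_congr rfl fun j _ => by rw [blueWeight]; ring
  rw [hI]; ring

end System

end LeaderFollower

theorem mainTheorem4 {V : Type*} [Fintype V] [DecidableEq V]
    (G : SimpleGraph V) [DecidableRel G.Adj] (hG : G.Connected)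
    (ν : V → V → ℝ) (hν_pos : ∀ i j, G.Adj i j → 0 < ν i j)
    (hν_symm : ∀ i j, G.Adj i j → ν i j = ν j i)
    (S : Finset V) (hS : S.Nonempty)
    (r : V → V → ℝ) (xl : {i // i ∈ S} → ℝ)
    {Ω : Type*} [MeasurableSpace Ω] (P : Measure Ω) [IsProbabilityMeasure P]
    (β : V → V → ℝ → Ω → ℝ)
    (hβ : ∀ i j, G.Adj i j → LeaderFollower.IsIntegratedWhiteNoise (β i j) (ν i j) P)
    (hβ_indep : iIndepFun (fun (l : G.Dart) (ω : Ω) (t : ℝ≥0) => β l.fst l.snd (t : ℝ) ω) P)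
    (x : V → ℝ → Ω → ℝ)
    (hx0 : ∀ i ∉ S, MemLp (x i 0) 2 P)
    (hx : LeaderFollower.IsSolution G ν S r xl β x P) :
    -- `L_ff` is invertible
    IsUnit (LeaderFollower.Lff G ν S).det ∧
    -- `x_f*` consists of the follower coordinates of any `y` that realizes the desired differences
    -- and agrees with the leader states
    (∀ y : V → ℝ, (∀ i j, G.Adj i j → y i - y j = r i j) → (∀ l : {i // i ∈ S}, y l = xl l) →
      ∀ i : {i // i ∉ S}, y i = LeaderFollower.desiredState G ν S r xl i) ∧
    -- the mean-square error is finite at all times, and converges to `R(S)`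
    (∀ t : ℝ, 0 ≤ t → Integrable (LeaderFollower.squaredError G ν S r xl x t) P) ∧
    Tendsto (LeaderFollower.totalError G ν S r xl x P) atTop
      (𝓝 (1 / 2 * ((LeaderFollower.Lff G ν S)⁻¹).trace)) ∧
    1 / 2 * ((LeaderFollower.Lff G ν S)⁻¹).trace =
      1 / 2 * ∑ u : {i // i ∉ S}, (LeaderFollower.Lff G ν S)⁻¹ u u := by
  open LeaderFollower in
  have hK := Lff_posDef (ν := ν) (S := S) hG hν_pos hν_symm hS
  have hdet : IsUnit (Lff G ν S).det := hK.det_pos.ne'.isUnit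
  have hD : ∀ i : {i // i ∉ S}, 0 < weightedDegree G ν i := fun i =>
    weightedDegree_pos hG hν_pos hS i.2
  obtain ⟨a, T, R, ha, hRT, hdrift, hnoise, hinv⟩ := exists_diagonalization hK hD
  have hw := ((isNoiseFamily_of_iIndepFun (fun l : G.Dart => hβ l.fst l.snd l.adj)
    hβ_indep).linearCombination (weightMatrix G ν S)).linearCombination T
  rw [weightMatrix_mul_diagonal_mul hν_pos hD, hnoise] at hw
  have hX : ∀ k, MemLp
      (fun ω => ∑ i, T k i * (x i.val 0 ω - desiredState G ν S r xl i)) 2 P := fun k =>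
    memLp_finsetSum _ fun i _ => ((hx0 i i.2).sub (memLp_const _)).const_mul _
  have hmodes : ∀ t : ℝ, 0 ≤ t → ∀ᵐ ω ∂P, squaredError G ν S r xl x t ω
      = ∑ i, (∑ k, R i k * (Real.exp (-a k * t)
          * (∑ i, T k i * (x i.val 0 ω - desiredState G ν S r xl i))
        + (expAverage (a k)
            (fun s => ∑ i, T k i * ∑ l : G.Dart, weightMatrix G ν S i l * β l.fst l.snd s ω) t
          - ∑ i, T k i * ∑ l : G.Dart, weightMatrix G ν S i l * β l.fst l.snd t ω))) ^ 2 := by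
    intro t ht
    filter_upwards [hx.ae_error_eq hdet, hx.intervalIntegrable] with ω hω hint
    rw [squaredError_eq]
    refine Finset.sum_congr rfl fun i _ => ?_
    congr 1
    have hsol := fun k => modal_solution hdrift
      (y := fun i s => x i.val s ω - desiredState G ν S r xl i)
      (fun i s hs => (hint i i.2 s hs).sub (by simp)) hω k ht
    simp_rw [← hsol]
    have h := congrFun (congrArg
      (fun M => M *ᵥ fun j : {i // i ∉ S} => x j t ω - desiredState G ν S r xl j) hRT) i
    rw [← Matrix.mulVec_mulVec, Matrix.one_mulVec] at h
    exact h.symm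
  obtain ⟨hfin, hlim⟩ := tendsto_integral_sum_sq hw ha hX R hmodes
  rw [hinv] at hlim
  exact ⟨hdet, fun y hr hy i => eq_desiredState hdet r xl hr hy i, hfin, hlim, rfl⟩
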